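/- Let $\ell$ be a natural number and $\Omega>0$. Consider the set $\mathcal Q_2$ of all points $(t,x,z,v,w,y,u)\in\mathbb R\times\mathbb R^\ell\times\mathbb R^\ell\times\mathbb R^4$ with $$t\ge (y-v)^2+\Omega\Big(y-\sum_{i=1}^\ell x_i\Big)^2,\quad x_i(1-z_i)=0\ (i\in[\ell]),\quad v(1-w)=0,\quad y(1-u)=0,\quad z\in\{0,1\}^\ell,\ w,u\in\{0,1\}.$$ Then the closed convex hull of $\mathcal Q_2$ (the closure of its convex hull) is the set of all $(t,x,z,v,w,y,u)$ for which there are real values of the additional variables below (the superscript names a piece, $i\in[\ell]$) such that \begin{align*} &t\ge \sum_{i}( t^{V_i}+t^{V_{iy}}+t^{V_{iv}})+t^{V_{y}}+t^{V_v}+t^{V_{yv}}\\ &x_i = x^{V_i}_i+x_{i}^{V_{iy}}+x_{i}^{V_{iv}}+x_i^{R}&\forall i\in[\ell]\\ &y = y^{V_y}+\sum_{i} y^{V_{iy}}+y^{V_{yv}}+y^{R},\qquad v=v^{V_v}+\sum_{i} v^{V_{iv}}+v^{V_{yv}}+v^{R}\\ &y^{R}=v^{R}=\sum_{i} x_i^{R}\\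 &\lambda^{V_i}+\lambda^{V_{iy}}+\lambda^{V_{iv}}+\lambda^{R}\le z_i\le 1&\forall i\in[\ell]\\ &\lambda^{V_y}+\sum_{i} \lambda^{V_{iy}}+\lambda^{V_{yv}}+\lambda^{R}\le u\le 1\\ &\lambda^{V_v}+\sum_{i} \lambda^{V_{iv}}+\lambda^{V_{yv}}+\lambda^{R}\le w\le 1\\ &\sum_i\lambda^{V_i}+\sum_i\lambda^{V_{iy}}+\sum_i\lambda^{V_{iv}}+\lambda^{V_y}+\lambda^{V_v}+\lambda^{V_{yv}}+\lambda^{R}\le 1\\ &\text{all the variables } \lambda \text{ and all the variables } t^{V_i},t^{V_{iy}},t^{V_{iv}},t^{V_y},t^{V_v},t^{V_{yv}} \text{ are nonnegative}\\ &t^{V_{i}}\lambda^{V_i}\ge \Omega (x_i^{V_i})^2,\quad t^{V_{iy}}\lambda^{V_{iy}}\ge (y^{V_{iy}})^2+\Omega( y^{V_{iy}} -x_i^{V_{iy}})^2,\quad t^{V_{iv}}\lambda^{V_{iv}}\ge (v^{V_{iv}})^2+\Omega (x_{i}^{V_{iv}})^2&\forall i\in[\ell]\\ &t^{V_y}\lambda^{V_y}\ge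 (1+\Omega)( y^{V_y})^2,\quad t^{V_v}\lambda^{V_v}\ge ( v^{V_v})^2,\quad t^{V_{yv}}\lambda^{V_{yv}}\ge(y^{V_{yv}}-v^{V_{yv}})^2+\Omega (y^{V_{yv}})^2. \end{align*} The number of additional variables is $12\ell+13=O(\ell)$. Moreover, the closed convex hull of $\mathcal Q_2$ equals that of the union of the following pieces, where $i$ ranges over $[\ell]$ and where in every piece the components of $z$ and the values $w,u$ that are not set to $1$ range over $\{0,1\}$: \begin{align*} &V_0:\ t\ge0,\ x=0,\ v=y=0;\\ &V_i:\ t\ge\Omega x_i^2,\ z_i=1,\ v=y=0,\ x_j=0\ (j\ne i);\\ &V_y:\ t\ge(1+\Omega)y^2,\ u=1,\ v=0,\ x=0;\\ &V_v:\ t\ge v^2,\ w=1,\ y=0,\ x=0;\\ &V_{yv}:\ t\ge (y-v)^2+\Omega y^2,\ w=u=1,\ x=0;\\ &V_{iy}:\ t\ge y^2+\Omega(y-x_i)^2,\ z_i=u=1,\ v=0,\ x_j=0\ (j\ne i);\\ &V_{iv}:\ t\ge v^2+\Omega x_i^2,\ z_i=w=1,\ y=0,\ x_j=0\ (j\ne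 i);\\ &R:\ t\ge0,\ y=v=\sum_j x_j,\ z_j=w=u=1\ (\text{all } j). \end{align*} -/

import Mathlib

namespace SignalDenoising

/-- The space `ℝ × ℝ^ℓ × ℝ^ℓ × ℝ × ℝ × ℝ × ℝ` of the points `(t, x, z, v, w, y, u)`. -/
abbrev Point (ℓ : ℕ) : Type :=
  ℝ × (Fin ℓ → ℝ) × (Fin ℓ → ℝ) × ℝ × ℝ × ℝ × ℝ

/-- A real number is binary if it is `0` or `1`. -/
def Binary (r : ℝ) : Prop := r = 0 ∨ r = 1

/-- The rank-two mixed-integer set of signal denoising. -/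
def Q₂ (ℓ : ℕ) (Ω : ℝ) : Set (Point ℓ) :=
  {p | match p with
    | (t, x, z, v, w, y, u) =>
      t ≥ (y - v) ^ 2 + Ω * (y - ∑ i, x i) ^ 2 ∧
      (∀ i, x i * (1 - z i) = 0) ∧ v * (1 - w) = 0 ∧ y * (1 - u) = 0 ∧
      (∀ i, Binary (z i)) ∧ Binary w ∧ Binary u}

/-! ### The pieces of the disjunction -/

/-- All the continuous variables vanish. -/
def V₀ (ℓ : ℕ) : Set (Point ℓ) :=
  {p | match p with
    | (t, x, z, v, w, y, u) =>
      t ≥ 0 ∧ (∀ j, x j = 0) ∧ v = 0 ∧ y = 0 ∧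
      (∀ j, Binary (z j)) ∧ Binary w ∧ Binary u}

/-- Only `x i` may be nonzero. -/
def Vᵢ (ℓ : ℕ) (Ω : ℝ) (i : Fin ℓ) : Set (Point ℓ) :=
  {p | match p with
    | (t, x, z, v, w, y, u) =>
      t ≥ Ω * x i ^ 2 ∧ (∀ j, j ≠ i → x j = 0) ∧ v = 0 ∧ y = 0 ∧
      z i = 1 ∧ (∀ j, j ≠ i → Binary (z j)) ∧ Binary w ∧ Binary u}

/-- Only `y` may be nonzero. -/
def Vy (ℓ : ℕ) (Ω : ℝ) : Set (Point ℓ) :=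
  {p | match p with
    | (t, x, z, v, w, y, u) =>
      t ≥ (1 + Ω) * y ^ 2 ∧ (∀ j, x j = 0) ∧ v = 0 ∧
      u = 1 ∧ (∀ j, Binary (z j)) ∧ Binary w}

/-- Only `v` may be nonzero. -/
def Vv (ℓ : ℕ) : Set (Point ℓ) :=
  {p | match p with
    | (t, x, z, v, w, y, u) =>
      t ≥ v ^ 2 ∧ (∀ j, x j = 0) ∧ y = 0 ∧
      w = 1 ∧ (∀ j, Binary (z j)) ∧ Binary u}

/-- Only `y` and `v` may be nonzero. -/
def Vyv (ℓ : ℕ) (Ω : ℝ) : Set (Point ℓ) :=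
  {p | match p with
    | (t, x, z, v, w, y, u) =>
      t ≥ (y - v) ^ 2 + Ω * y ^ 2 ∧ (∀ j, x j = 0) ∧
      w = 1 ∧ u = 1 ∧ (∀ j, Binary (z j))}

/-- Only `x i` and `y` may be nonzero. -/
def Vᵢy (ℓ : ℕ) (Ω : ℝ) (i : Fin ℓ) : Set (Point ℓ) :=
  {p | match p with
    | (t, x, z, v, w, y, u) =>
      t ≥ y ^ 2 + Ω * (y - x i) ^ 2 ∧ (∀ j, j ≠ i → x j = 0) ∧ v = 0 ∧
      z i = 1 ∧ u = 1 ∧ (∀ j, j ≠ i → Binary (z j)) ∧ Binary w}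

/-- Only `x i` and `v` may be nonzero. -/
def Vᵢv (ℓ : ℕ) (Ω : ℝ) (i : Fin ℓ) : Set (Point ℓ) :=
  {p | match p with
    | (t, x, z, v, w, y, u) =>
      t ≥ v ^ 2 + Ω * x i ^ 2 ∧ (∀ j, j ≠ i → x j = 0) ∧ y = 0 ∧
      z i = 1 ∧ w = 1 ∧ (∀ j, j ≠ i → Binary (z j)) ∧ Binary u}

/-- The points at which both squares vanish, with all the binary variables equal to `1`. -/
def R (ℓ : ℕ) : Set (Point ℓ) :=
  {p | match p with
    | (t, x, z, v, w, y, u) =>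
      t ≥ 0 ∧ y - v = 0 ∧ y = ∑ j, x j ∧ (∀ j, z j = 1) ∧ w = 1 ∧ u = 1}

/-! ### The extended formulation -/

/-- The names of the additional scalar variables. The letter before the underscore is the
variable (`lam` for the multiplier `λ`), the letters after it name the piece: `x_iy i` is
the variable `x_i` of the piece `Vᵢy`, `x_R i` the variable `x_i` of the piece `R`. -/
inductive AuxVar (ℓ : ℕ) : Type
  | t_i (i : Fin ℓ) | t_y | t_v | t_yv | t_iy (i : Fin ℓ) | t_iv (i : Fin ℓ)
  | x_i (i : Fin ℓ) | x_iy (i : Fin ℓ) | x_iv (i : Fin ℓ) | x_R (i : Fin ℓ)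
  | y_y | y_iy (i : Fin ℓ) | y_yv | y_R
  | v_v | v_iv (i : Fin ℓ) | v_yv | v_R
  | lam_i (i : Fin ℓ) | lam_y | lam_v | lam_yv | lam_iy (i : Fin ℓ) | lam_iv (i : Fin ℓ)
  | lam_R

/-- The rotated cone constraint `s ≤ t λ` with `t, λ ≥ 0`. -/
def RotatedCone (t lam s : ℝ) : Prop := 0 ≤ t ∧ 0 ≤ lam ∧ t * lam ≥ s

/-- The extended formulation: the points `(t, x, z, v, w, y, u)` together with values `a` of
the additional variables that satisfy the system. -/
def extendedFormulation (ℓ : ℕ) (Ω : ℝ) : Set (Point ℓ × (AuxVar ℓ → ℝ)) :=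
  {q | match q with
    | ((t, x, z, v, w, y, u), a) =>
      t ≥ ∑ i, (a (.t_i i) + a (.t_iy i) + a (.t_iv i)) + a .t_y + a .t_v + a .t_yv ∧
      (∀ i, x i = a (.x_i i) + a (.x_iy i) + a (.x_iv i) + a (.x_R i)) ∧
      y = a .y_y + ∑ i, a (.y_iy i) + a .y_yv + a .y_R ∧
      v = a .v_v + ∑ i, a (.v_iv i) + a .v_yv + a .v_R ∧
      a .y_R = a .v_R ∧ a .v_R = ∑ i, a (.x_R i) ∧
      (∀ i, a (.lam_i i) + a (.lam_iy i) + a (.lam_iv i) + a .lam_R ≤ z i ∧ z i ≤ 1) ∧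
      (a .lam_y + ∑ i, a (.lam_iy i) + a .lam_yv + a .lam_R ≤ u ∧ u ≤ 1) ∧
      (a .lam_v + ∑ i, a (.lam_iv i) + a .lam_yv + a .lam_R ≤ w ∧ w ≤ 1) ∧
      ∑ i, a (.lam_i i) + ∑ i, a (.lam_iy i) + ∑ i, a (.lam_iv i)
        + a .lam_y + a .lam_v + a .lam_yv + a .lam_R ≤ 1 ∧
      0 ≤ a .lam_R ∧
      (∀ i, RotatedCone (a (.t_i i)) (a (.lam_i i)) (Ω * a (.x_i i) ^ 2)) ∧
      RotatedCone (a .t_y) (a .lam_y) ((1 + Ω) * a .y_y ^ 2) ∧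
      RotatedCone (a .t_v) (a .lam_v) (a .v_v ^ 2) ∧
      (∀ i, RotatedCone (a (.t_iy i)) (a (.lam_iy i))
        (a (.y_iy i) ^ 2 + Ω * (a (.y_iy i) - a (.x_iy i)) ^ 2)) ∧
      (∀ i, RotatedCone (a (.t_iv i)) (a (.lam_iv i))
        (a (.v_iv i) ^ 2 + Ω * a (.x_iv i) ^ 2)) ∧
      RotatedCone (a .t_yv) (a .lam_yv) ((a .y_yv - a .v_yv) ^ 2 + Ω * a .y_yv ^ 2)}

end SignalDenoising

/-!
Let `E` be the projection of the extended formulation. Then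
`pieces ⊆ Q₂ ⊆ E ⊆ closure (convexHull pieces)`, and `E` is closed and convex, so all three sets
in the statement coincide.

* `pieces ⊆ Q₂` is immediate (`pieces_subset_Q₂`).
* `Q₂ ⊆ E` (`Q₂_subset_projection`) rests on the recession directions in which `y`, `v` and `∑ x`
  change by the same amount. They leave both squares unchanged, and the extended formulation
  contains them, as it allows the variables of `R` to be nonzero at `λ^R = 0`. One nonzero `x i`
  can thus take over the role of the whole vector `x`.
* `E` is convex because rotated cones are (`RotatedCone.comb`), and closed because the additional
  variables are bounded over bounded sets of points (`exists_bound_auxVar`).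
* `E ⊆ closure (convexHull pieces)` (`projection_subset_closure_convexHull_pieces`) is proved
  dually: every linear inequality valid on the pieces is valid on `E`. This avoids the
  approximations that a primal argument needs when multipliers vanish.
-/

namespace SignalDenoising

open Filter Topology

/-! ### Convexity of the extended formulation -/

/-- The rotated cone over a positive semidefinite diagonal quadratic form is convex: after
expanding, the cross terms are controlled by Cauchy–Schwarz and the arithmetic-geometric mean
inequality. -/
lemma RotatedCone.comb {Ω a b t₁ t₂ l₁ l₂ A₁ A₂ B₁ B₂ : ℝ} (hΩ : 0 ≤ Ω) (ha : 0 ≤ a) (hb : 0 ≤ b)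
    (h₁ : RotatedCone t₁ l₁ (A₁ ^ 2 + Ω * B₁ ^ 2))
    (h₂ : RotatedCone t₂ l₂ (A₂ ^ 2 + Ω * B₂ ^ 2)) :
    RotatedCone (a * t₁ + b * t₂) (a * l₁ + b * l₂)
      ((a * A₁ + b * A₂) ^ 2 + Ω * (a * B₁ + b * B₂) ^ 2) := by
  obtain ⟨ht₁, hl₁, h₁⟩ := h₁
  obtain ⟨ht₂, hl₂, h₂⟩ := h₂
  refine ⟨by positivity, by positivity, ?_⟩
  have cross : 2 * (A₁ * A₂ + Ω * (B₁ * B₂)) ≤ t₁ * l₂ + t₂ * l₁ := by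
    refine le_trans (le_abs_self _) (abs_le_of_sq_le_sq ?_ (by positivity))
    have cs : (A₁ * A₂ + Ω * (B₁ * B₂)) ^ 2 ≤
        (A₁ ^ 2 + Ω * B₁ ^ 2) * (A₂ ^ 2 + Ω * B₂ ^ 2) := by
      have : 0 ≤ Ω * (A₁ * B₂ - A₂ * B₁) ^ 2 := by positivity
      linarith
    have pr : (A₁ ^ 2 + Ω * B₁ ^ 2) * (A₂ ^ 2 + Ω * B₂ ^ 2) ≤ (t₁ * l₁) * (t₂ * l₂) :=
      mul_le_mul h₁ h₂ (by positivity) (by positivity)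
    have := sq_nonneg (t₁ * l₂ - t₂ * l₁)
    linarith
  have e₁ := mul_le_mul_of_nonneg_left h₁ (mul_nonneg ha ha)
  have e₂ := mul_le_mul_of_nonneg_left h₂ (mul_nonneg hb hb)
  have e₃ := mul_le_mul_of_nonneg_left cross (mul_nonneg ha hb)
  linarith

lemma convex_extendedFormulation {ℓ : ℕ} {Ω : ℝ} (hΩ : 0 < Ω) :
    Convex ℝ (extendedFormulation ℓ Ω) := by
  rintro ⟨⟨t, x, z, v, w, y, u⟩, A⟩ ⟨h1, h2, h3, h4, h5, h6, h7, h8, h9, h10, h11, h12, h13, h14,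
    h15, h16, h17⟩ ⟨⟨t', x', z', v', w', y', u'⟩, B⟩ ⟨k1, k2, k3, k4, k5, k6, k7, k8, k9, k10, k11,
    k12, k13, k14, k15, k16, k17⟩ a b ha hb hab
  have comb : ∀ {p q p' q' : ℝ}, p ≤ q → p' ≤ q' → a * p + b * p' ≤ a * q + b * q' :=
    fun h k ↦ add_le_add (mul_le_mul_of_nonneg_left h ha) (mul_le_mul_of_nonneg_left k hb)
  have comb_one : ∀ {p p' : ℝ}, p ≤ 1 → p' ≤ 1 → a * p + b * p' ≤ 1 := fun h k ↦ by
    have := comb h k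
    linarith
  simp only [extendedFormulation, Set.mem_ofPred_eq, Prod.smul_mk, Prod.mk_add_mk, Pi.add_apply,
    Pi.smul_apply, smul_eq_mul, Finset.sum_add_distrib, ← Finset.mul_sum] at *
  refine ⟨?_, fun i ↦ ?_, ?_, ?_, ?_, ?_, fun i ↦ ⟨?_, ?_⟩, ⟨?_, ?_⟩, ⟨?_, ?_⟩, ?_, ?_,
    fun i ↦ ?_, ?_, ?_, fun i ↦ ?_, fun i ↦ ?_, ?_⟩
  · linarith [comb h1 k1]
  · linear_combination a * h2 i + b * k2 i
  · linear_combination a * h3 + b * k3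
  · linear_combination a * h4 + b * k4
  · linear_combination a * h5 + b * k5
  · linear_combination a * h6 + b * k6
  · linarith [comb (h7 i).1 (k7 i).1]
  · exact comb_one (h7 i).2 (k7 i).2
  · linarith [comb h8.1 k8.1]
  · exact comb_one h8.2 k8.2
  · linarith [comb h9.1 k9.1]
  · exact comb_one h9.2 k9.2
  · linarith [comb_one h10 k10]
  · positivity
  · have := RotatedCone.comb (A₁ := 0) (A₂ := 0) hΩ.le ha hb
      (by simpa using h12 i) (by simpa using k12 i)
    simpa using this
  · have := RotatedCone.comb (A₁ := A .y_y) (A₂ := B .y_y) (B₁ := A .y_y) (B₂ := B .y_y) hΩ.le ha hb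
      (by convert h13 using 1; ring) (by convert k13 using 1; ring)
    convert this using 1; ring
  · have := RotatedCone.comb (B₁ := 0) (B₂ := 0) hΩ.le ha hb
      (by simpa using h14) (by simpa using k14)
    simpa using this
  · convert RotatedCone.comb hΩ.le ha hb (h15 i) (k15 i) using 1; ring
  · exact RotatedCone.comb hΩ.le ha hb (h16 i) (k16 i)
  · convert RotatedCone.comb hΩ.le ha hb h17 k17 using 1; ring

lemma convex_projection {ℓ : ℕ} {Ω : ℝ} (hΩ : 0 < Ω) :
    Convex ℝ {p : Point ℓ | ∃ a, (p, a) ∈ extendedFormulation ℓ Ω} := by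
  rintro p ⟨a, ha⟩ q ⟨b, hb⟩ r s hr hs hrs
  exact ⟨r • a + s • b, convex_extendedFormulation hΩ ha hb hr hs hrs⟩

/-! ### Counting the additional variables -/

/-- The additional variables are `12` families indexed by `Fin ℓ` and `13` single variables. -/
def auxVarEquiv (ℓ : ℕ) : AuxVar ℓ ≃ (Fin 12 × Fin ℓ) ⊕ Fin 13 where
  toFun
    | .t_i i => .inl (0, i) | .t_iy i => .inl (1, i) | .t_iv i => .inl (2, i)
    | .x_i i => .inl (3, i) | .x_iy i => .inl (4, i) | .x_iv i => .inl (5, i)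
    | .x_R i => .inl (6, i) | .y_iy i => .inl (7, i) | .v_iv i => .inl (8, i)
    | .lam_i i => .inl (9, i) | .lam_iy i => .inl (10, i) | .lam_iv i => .inl (11, i)
    | .t_y => .inr 0 | .t_v => .inr 1 | .t_yv => .inr 2
    | .y_y => .inr 3 | .y_yv => .inr 4 | .y_R => .inr 5
    | .v_v => .inr 6 | .v_yv => .inr 7 | .v_R => .inr 8
    | .lam_y => .inr 9 | .lam_v => .inr 10 | .lam_yv => .inr 11 | .lam_R => .inr 12
  invFun
    | .inl (k, i) => ![.t_i i, .t_iy i, .t_iv i, .x_i i, .x_iy i, .x_iv i, .x_R i, .y_iy i,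
        .v_iv i, .lam_i i, .lam_iy i, .lam_iv i] k
    | .inr k => ![.t_y, .t_v, .t_yv, .y_y, .y_yv, .y_R, .v_v, .v_yv, .v_R, .lam_y, .lam_v,
        .lam_yv, .lam_R] k
  left_inv k := by cases k <;> rfl
  right_inv k := by
    rcases k with ⟨k, i⟩ | k <;> fin_cases k <;> rfl

instance (ℓ : ℕ) : Finite (AuxVar ℓ) := Finite.of_equiv _ (auxVarEquiv ℓ).symm

lemma card_auxVar (ℓ : ℕ) : Nat.card (AuxVar ℓ) = 12 * ℓ + 13 := by
  simp [Nat.card_congr (auxVarEquiv ℓ)]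

/-! ### Closedness of the projection -/

lemma isClosed_extendedFormulation (ℓ : ℕ) (Ω : ℝ) : IsClosed (extendedFormulation ℓ Ω) := by
  simp only [extendedFormulation, RotatedCone, ge_iff_le, Set.ofPred_and, Set.ofPred_forall]
  repeat' first
    | apply IsClosed.inter
    | refine isClosed_iInter fun i ↦ ?_
    | exact isClosed_le (by fun_prop) (by fun_prop)
    | exact isClosed_eq (by fun_prop) (by fun_prop)

/-- The additional variables are bounded over bounded sets of points. The multipliers are at most
`1` and the variables `t` of the pieces at most `t`, so the cones bound every continuous variable
outside `R`; those of `R` are then determined by the linear equations. -/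
lemma exists_bound_auxVar {ℓ : ℕ} {Ω : ℝ} (hΩ : 0 < Ω) (M : ℝ) :
    ∃ B : ℝ, ∀ p : Point ℓ, ‖p‖ ≤ M → ∀ a, (p, a) ∈ extendedFormulation ℓ Ω → ∀ k, |a k| ≤ B := by
  set S : ℝ := 1 + M + M / Ω with hS
  refine ⟨(ℓ + 5) * S, ?_⟩
  rintro ⟨t, x, z, v, w, y, u⟩ hp a ⟨h1, h2, h3, h4, h5, h6, h7, h8, h9, h10, h11, h12, h13, h14,
    h15, h16, h17⟩
  have hM : 0 ≤ M := (norm_nonneg _).trans hp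
  simp only [Prod.norm_def, sup_le_iff, Real.norm_eq_abs] at hp
  obtain ⟨pt, px, -, pv, -, py, -⟩ := hp
  have px : ∀ i, |x i| ≤ M := fun i ↦ (norm_le_pi_norm x i).trans px
  have ht := (le_abs_self t).trans pt
  have hMΩ : 0 ≤ M / Ω := by positivity
  have hMS : M ≤ S := by linarith
  have h1S : 1 ≤ S := by linarith
  have ti := fun i ↦ (h12 i).1
  have tiy := fun i ↦ (h15 i).1
  have tiv := fun i ↦ (h16 i).1
  have li := fun i ↦ (h12 i).2.1
  have liy := fun i ↦ (h15 i).2.1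
  have liv := fun i ↦ (h16 i).2.1
  have ty := h13.1
  have tv := h14.1
  have tyv := h17.1
  have ly := h13.2.1
  have lv := h14.2.1
  have lyv := h17.2.1
  have le_sum : ∀ g : Fin ℓ → ℝ, (∀ i, 0 ≤ g i) → ∀ i, g i ≤ ∑ j, g j := fun g hg i ↦
    Finset.single_le_sum (fun j _ ↦ hg j) (Finset.mem_univ i)
  have sum_nonneg : ∀ g : Fin ℓ → ℝ, (∀ i, 0 ≤ g i) → 0 ≤ ∑ j, g j := fun g hg ↦
    Finset.sum_nonneg fun j _ ↦ hg j
  have sti := sum_nonneg _ ti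
  have stiy := sum_nonneg _ tiy
  have stiv := sum_nonneg _ tiv
  have sli := sum_nonneg _ li
  have sliy := sum_nonneg _ liy
  have sliv := sum_nonneg _ liv
  simp only [Finset.sum_add_distrib] at h1
  have bti : ∀ i, a (.t_i i) ≤ M := fun i ↦ by linarith [le_sum _ ti i]
  have btiy : ∀ i, a (.t_iy i) ≤ M := fun i ↦ by linarith [le_sum _ tiy i]
  have btiv : ∀ i, a (.t_iv i) ≤ M := fun i ↦ by linarith [le_sum _ tiv i]
  have bty : a .t_y ≤ M := by linarith
  have btv : a .t_v ≤ M := by linarith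
  have btyv : a .t_yv ≤ M := by linarith
  have bli : ∀ i, a (.lam_i i) ≤ 1 := fun i ↦ by linarith [le_sum _ li i]
  have bliy : ∀ i, a (.lam_iy i) ≤ 1 := fun i ↦ by linarith [le_sum _ liy i]
  have bliv : ∀ i, a (.lam_iv i) ≤ 1 := fun i ↦ by linarith [le_sum _ liv i]
  have bly : a .lam_y ≤ 1 := by linarith
  have blv : a .lam_v ≤ 1 := by linarith
  have blyv : a .lam_yv ≤ 1 := by linarith
  have blR : a .lam_R ≤ 1 := by linarith
  have cone : ∀ {t l s : ℝ}, RotatedCone t l s → t ≤ M → l ≤ 1 → s ≤ M := fun h k k' ↦ by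
    have := mul_le_mul k k' h.2.1 hM
    linarith [h.2.2]
  have root : ∀ {s : ℝ}, s ^ 2 ≤ M → |s| ≤ S := fun {s} h ↦ by
    rw [← sq_abs] at h
    nlinarith [sq_nonneg (|s| - 1)]
  have rootΩ : ∀ {s : ℝ}, Ω * s ^ 2 ≤ M → |s| ≤ S := fun {s} h ↦ by
    have h : s ^ 2 ≤ M / Ω := by rw [le_div_iff₀ hΩ]; linarith
    rw [← sq_abs] at h
    nlinarith [sq_nonneg (|s| - 1)]
  have pos : ∀ s : ℝ, 0 ≤ Ω * s ^ 2 := fun s ↦ by positivity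
  have c12 := fun i ↦ abs_le.1 (rootΩ (cone (h12 i) (bti i) (bli i)))
  have c13 : |a .y_y| ≤ S := root (by linarith [cone h13 bty bly, pos (a .y_y)])
  have c14 := root (cone h14 btv blv)
  have c15 : ∀ i, |a (.y_iy i)| ≤ S := fun i ↦ root
    (by linarith [cone (h15 i) (btiy i) (bliy i), pos (a (.y_iy i) - a (.x_iy i))])
  have c15' : ∀ i, |a (.y_iy i) - a (.x_iy i)| ≤ S := fun i ↦ rootΩ
    (by linarith [cone (h15 i) (btiy i) (bliy i), sq_nonneg (a (.y_iy i))])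
  have c16 : ∀ i, |a (.v_iv i)| ≤ S := fun i ↦ root
    (by linarith [cone (h16 i) (btiv i) (bliv i), pos (a (.x_iv i))])
  have c16' : ∀ i, |a (.x_iv i)| ≤ S := fun i ↦ rootΩ
    (by linarith [cone (h16 i) (btiv i) (bliv i), sq_nonneg (a (.v_iv i))])
  have c17 : |a .y_yv - a .v_yv| ≤ S := root
    (by linarith [cone h17 btyv blyv, pos (a .y_yv)])
  have c17' : |a .y_yv| ≤ S := rootΩ
    (by linarith [cone h17 btyv blyv, sq_nonneg (a .y_yv - a .v_yv)])
  have sumy : |∑ i, a (.y_iy i)| ≤ ℓ * S := by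
    refine (Finset.abs_sum_le_sum_abs _ _).trans ((Finset.sum_le_sum fun i _ ↦ c15 i).trans ?_)
    simp
  have hℓ : 0 ≤ (ℓ : ℝ) * S := by positivity
  rw [abs_le] at c13 c14 c17 c17' sumy py
  simp only [abs_le] at c15 c15' c16 c16' px
  have byR : -((ℓ + 5) * S) ≤ a .y_R ∧ a .y_R ≤ (ℓ + 5) * S := by
    constructor <;> linarith only [h3, c13, c17', sumy, py, hMS, h1S]
  have small : ∀ {s : ℝ}, -(4 * S) ≤ s → s ≤ 4 * S →
      -((ℓ + 5) * S) ≤ s ∧ s ≤ (ℓ + 5) * S := fun h k ↦ by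
    constructor <;> linarith only [h, k, hℓ]
  have sym : ∀ {s : ℝ}, -S ≤ s ∧ s ≤ S → -((ℓ + 5) * S) ≤ s ∧ s ≤ (ℓ + 5) * S := fun h ↦
    small (by linarith only [h.1, h1S]) (by linarith only [h.2, h1S])
  have nonneg : ∀ {s : ℝ}, 0 ≤ s → s ≤ S → -((ℓ + 5) * S) ≤ s ∧ s ≤ (ℓ + 5) * S := fun h k ↦
    sym ⟨by linarith only [h, h1S], k⟩
  intro k
  rw [abs_le]
  cases k with
  | t_i i => exact nonneg (ti i) ((bti i).trans hMS)
  | t_y => exact nonneg ty (bty.trans hMS)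
  | t_v => exact nonneg tv (btv.trans hMS)
  | t_yv => exact nonneg tyv (btyv.trans hMS)
  | t_iy i => exact nonneg (tiy i) ((btiy i).trans hMS)
  | t_iv i => exact nonneg (tiv i) ((btiv i).trans hMS)
  | x_i i => exact sym (c12 i)
  | x_iy i => apply small <;> linarith only [c15 i, c15' i, h1S]
  | x_iv i => exact sym (c16' i)
  | x_R i =>
    have := h2 i
    constructor <;> linarith only [c12 i, c15 i, c15' i, c16' i, px i, this, hMS, h1S, hℓ]
  | y_y => exact sym c13
  | y_iy i => exact sym (c15 i)
  | y_yv => exact sym c17'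
  | y_R => exact byR
  | v_v => exact sym c14
  | v_iv i => exact sym (c16 i)
  | v_yv => apply small <;> linarith only [c17, c17', h1S]
  | v_R => exact h5 ▸ byR
  | lam_i i => exact nonneg (li i) ((bli i).trans h1S)
  | lam_y => exact nonneg ly (bly.trans h1S)
  | lam_v => exact nonneg lv (blv.trans h1S)
  | lam_yv => exact nonneg lyv (blyv.trans h1S)
  | lam_iy i => exact nonneg (liy i) ((bliy i).trans h1S)
  | lam_iv i => exact nonneg (liv i) ((bliv i).trans h1S)
  | lam_R => exact nonneg h11 (blR.trans h1S)

/-- A projection along a closed set with fibres that are locally uniformly bounded is closed. -/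
lemma isClosed_projection {ℓ : ℕ} {Ω : ℝ} (hΩ : 0 < Ω) :
    IsClosed {p : Point ℓ | ∃ a, (p, a) ∈ extendedFormulation ℓ Ω} := by
  refine IsSeqClosed.isClosed fun p q hp hq ↦ ?_
  choose a ha using hp
  obtain ⟨M, hM⟩ := hq.norm.bddAbove_range
  obtain ⟨B, hB⟩ := exists_bound_auxVar (ℓ := ℓ) hΩ M
  have hmem : ∀ n, a n ∈ Set.univ.pi fun _ : AuxVar ℓ ↦ Set.Icc (-B) B := fun n k _ ↦
    abs_le.1 (hB (p n) (hM ⟨n, rfl⟩) (a n) (ha n) k)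
  obtain ⟨b, -, φ, hφ, hb⟩ :=
    (isCompact_univ_pi fun _ : AuxVar ℓ ↦ isCompact_Icc).tendsto_subseq hmem
  exact ⟨b, (isClosed_extendedFormulation ℓ Ω).mem_of_tendsto
    ((hq.comp hφ.tendsto_atTop).prodMk_nhds hb) (Eventually.of_forall fun n ↦ ha (φ n))⟩

/-! ### The pieces, the mixed-integer set and the extended formulation -/

/-- The union of the pieces of the disjunction. -/
def pieces (ℓ : ℕ) (Ω : ℝ) : Set (Point ℓ) :=
  V₀ ℓ ∪ (⋃ i, Vᵢ ℓ Ω i) ∪ Vy ℓ Ω ∪ Vv ℓ ∪ Vyv ℓ Ω ∪ (⋃ i, Vᵢy ℓ Ω i) ∪ (⋃ i, Vᵢv ℓ Ω i) ∪ R ℓ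

lemma Binary.mem_Icc {r : ℝ} (h : Binary r) : 0 ≤ r ∧ r ≤ 1 := by
  rcases h with rfl | rfl <;> norm_num

lemma binary_one : Binary 1 := Or.inr rfl

lemma binary_of_ne {ι : Type*} {i : ι} {z : ι → ℝ} (hi : z i = 1)
    (h : ∀ j, j ≠ i → Binary (z j)) (j : ι) : Binary (z j) := by
  by_cases hj : j = i
  · exact hj ▸ Or.inr hi
  · exact h j hj

lemma mul_one_sub_eq_zero_of_ne {ι : Type*} {i : ι} {x z : ι → ℝ} (hi : z i = 1)
    (h : ∀ j, j ≠ i → x j = 0) (j : ι) : x j * (1 - z j) = 0 := by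
  by_cases hj : j = i
  · simp [hj, hi]
  · simp [h j hj]

lemma pieces_subset_Q₂ (ℓ : ℕ) (Ω : ℝ) : pieces ℓ Ω ⊆ Q₂ ℓ Ω := by
  simp only [pieces, Set.union_subset_iff, Set.iUnion_subset_iff]
  refine ⟨⟨⟨⟨⟨⟨⟨?_, fun i ↦ ?_⟩, ?_⟩, ?_⟩, ?_⟩, fun i ↦ ?_⟩, fun i ↦ ?_⟩, ?_⟩ <;>
    rintro ⟨t, x, z, v, w, y, u⟩ h
  · obtain ⟨ht, hx, rfl, rfl, hz, hw, hu⟩ := h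
    exact ⟨by simpa [hx] using ht, by simp [hx], by simp, by simp, hz, hw, hu⟩
  · obtain ⟨ht, hx, rfl, rfl, hi, hz, hw, hu⟩ := h
    have hs : ∑ j, x j = x i := Fintype.sum_eq_single i hx
    exact ⟨by rw [hs]; linarith, mul_one_sub_eq_zero_of_ne hi hx, by simp, by simp,
      binary_of_ne hi hz, hw, hu⟩
  · obtain ⟨ht, hx, rfl, rfl, hz, hw⟩ := h
    exact ⟨by simp only [hx, Finset.sum_const_zero]; linarith, by simp [hx], by simp, by simp,
      hz, hw, binary_one⟩
  · obtain ⟨ht, hx, rfl, rfl, hz, hu⟩ := h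
    exact ⟨by simpa [hx] using ht, by simp [hx], by simp, by simp, hz, binary_one, hu⟩
  · obtain ⟨ht, hx, rfl, rfl, hz⟩ := h
    exact ⟨by simpa [hx] using ht, by simp [hx], by simp, by simp, hz, binary_one, binary_one⟩
  · obtain ⟨ht, hx, rfl, hi, rfl, hz, hw⟩ := h
    have hs : ∑ j, x j = x i := Fintype.sum_eq_single i hx
    exact ⟨by rw [hs]; linarith, mul_one_sub_eq_zero_of_ne hi hx, by simp, by simp,
      binary_of_ne hi hz, hw, binary_one⟩
  · obtain ⟨ht, hx, rfl, hi, rfl, hz, hu⟩ := h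
    have hs : ∑ j, x j = x i := Fintype.sum_eq_single i hx
    exact ⟨by rw [hs]; linarith, mul_one_sub_eq_zero_of_ne hi hx, by simp, by simp,
      binary_of_ne hi hz, binary_one, hu⟩
  · obtain ⟨ht, hyv, hy, hz, rfl, rfl⟩ := h
    refine ⟨?_, by simp [hz], by simp, by simp, fun j ↦ Or.inr (hz j), binary_one, binary_one⟩
    rw [hyv, ← hy]
    simpa using ht

/-- Points of `Q₂` lie in the extended formulation, with `λ^R = 0`: the variables of `R` carry a
recession direction. If `x i ≠ 0`, shifting along such a direction moves the whole sum of `x` into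
coordinate `i` and, when `y ≠ 0`, also annihilates `v`, without changing `y - v` and `y - ∑ x`; the
shifted point lies in `Vᵢ`, `Vᵢy` or `Vᵢv`. If `x = 0`, the point is already in a piece. -/
lemma Q₂_subset_projection {ℓ : ℕ} {Ω : ℝ} (hΩ : 0 < Ω) :
    Q₂ ℓ Ω ⊆ {p | ∃ a, (p, a) ∈ extendedFormulation ℓ Ω} := by
  rintro ⟨t, x, z, v, w, y, u⟩ ⟨ht, hx, hv, hy, hz, hw, hu⟩
  have hz' := fun i ↦ (hz i).mem_Icc
  obtain ⟨hw0, hw1⟩ := hw.mem_Icc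
  obtain ⟨hu0, hu1⟩ := hu.mem_Icc
  have ht0 : 0 ≤ t := le_trans (by positivity) ht
  have one : ∀ {r s : ℝ}, r ≠ 0 → r * (1 - s) = 0 → s = 1 := fun h k ↦ by
    linarith [(mul_eq_zero.1 k).resolve_left h]
  set s := ∑ i, x i with hs
  by_cases h : ∃ i, x i ≠ 0
  · obtain ⟨i, hi⟩ := h
    have hzi : z i = 1 := one hi (hx i)
    by_cases hy0 : y = 0
    · by_cases hv0 : v = 0
      · refine ⟨fun
          | .t_i j => if j = i then t else 0
          | .lam_i j => if j = i then 1 else 0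
          | .x_i j => if j = i then s else 0
          | .x_R j => x j - if j = i then s else 0
          | _ => 0, ?_⟩
        subst hy0 hv0
        refine ⟨by simp, by simp, by simp, by simp, by simp, by simp [hs], fun j ↦ ?_,
          by simp [*], by simp [*], by simp, by simp, fun j ↦ ?_, ?_, ?_, ?_, ?_, ?_⟩
        · by_cases hj : j = i <;> simp [hj, hzi, hz']
        · by_cases hj : j = i <;> simp [hj, RotatedCone, ht0]
          linarith
        all_goals simp [RotatedCone]
      · have hw' := one hv0 hv
        refine ⟨fun
          | .t_iv j => if j = i then t else 0
          | .lam_iv j => if j = i then 1 else 0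
          | .v_iv j => if j = i then v else 0
          | .x_iv j => if j = i then s else 0
          | .x_R j => x j - if j = i then s else 0
          | _ => 0, ?_⟩
        subst hy0
        refine ⟨by simp, by simp, by simp, by simp, by simp, by simp [hs], fun j ↦ ?_,
          by simp [*], by simp [*], by simp, by simp, ?_, ?_, ?_, ?_, fun j ↦ ?_, ?_⟩
        · by_cases hj : j = i <;> simp [hj, hzi, hz']
        pick_goal 5
        · by_cases hj : j = i <;> simp [hj, RotatedCone, ht0]
          linarith
        all_goals simp [RotatedCone]
    · have hu' := one hy0 hy
      refine ⟨fun
        | .t_iy j => if j = i then t else 0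
        | .lam_iy j => if j = i then 1 else 0
        | .y_iy j => if j = i then y - v else 0
        | .x_iy j => if j = i then s - v else 0
        | .x_R j => x j - if j = i then s - v else 0
        | .y_R => v
        | .v_R => v
        | _ => 0, ?_⟩
      refine ⟨by simp, by simp, by simp, by simp, by simp, by simp [hs], fun j ↦ ?_,
        by simp [*], by simp [*], by simp, by simp, ?_, ?_, ?_, fun j ↦ ?_, ?_, ?_⟩
      · by_cases hj : j = i <;> simp [hj, hzi, hz']
      pick_goal 4
      · by_cases hj : j = i <;> simp [hj, RotatedCone, ht0]
        linarith
      all_goals simp [RotatedCone]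
  · push Not at h
    have hs0 : s = 0 := by simp [hs, h]
    rw [hs0] at ht
    by_cases hy0 : y = 0
    · subst hy0
      by_cases hv0 : v = 0
      · subst hv0
        refine ⟨fun _ ↦ 0, ?_⟩
        simp [extendedFormulation, RotatedCone, *]
      · have hw' := one hv0 hv
        refine ⟨fun
          | .t_v => t
          | .lam_v => 1
          | .v_v => v
          | _ => 0, ?_⟩
        simp [extendedFormulation, RotatedCone, *]
        linarith
    · have hu' := one hy0 hy
      by_cases hv0 : v = 0
      · subst hv0
        refine ⟨fun
          | .t_y => t
          | .lam_y => 1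
          | .y_y => y
          | _ => 0, ?_⟩
        simp [extendedFormulation, RotatedCone, *]
        linarith
      · have hw' := one hv0 hv
        refine ⟨fun
          | .t_yv => t
          | .lam_yv => 1
          | .y_yv => y
          | .v_yv => v
          | _ => 0, ?_⟩
        simp [extendedFormulation, RotatedCone, *]
        linarith

/-! ### Separation -/

lemma exists_coefficients {ℓ : ℕ} (f : Point ℓ →L[ℝ] ℝ) :
    ∃ (α : ℝ) (ξ γ : Fin ℓ → ℝ) (β ω η μ : ℝ), ∀ t x z v w y u,
      f (t, x, z, v, w, y, u) =
        α * t + ∑ i, ξ i * x i + ∑ i, γ i * z i + β * v + ω * w + η * y + μ * u := by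
  let e (i : Fin ℓ) : Fin ℓ → ℝ := fun j ↦ if i = j then 1 else 0
  refine ⟨f (1, 0), fun i ↦ f (0, e i, 0), fun i ↦ f (0, 0, e i, 0), f (0, 0, 0, 1, 0),
    f (0, 0, 0, 0, 1, 0), f (0, 0, 0, 0, 0, 1, 0), f (0, 0, 0, 0, 0, 0, 1),
    fun t x z v w y u ↦ ?_⟩
  have h : ((t, x, z, v, w, y, u) : Point ℓ) =
      t • (1, 0) + ∑ i, x i • (0, e i, 0) + ∑ i, z i • (0, 0, e i, 0) + v • (0, 0, 0, 1, 0) +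
        w • (0, 0, 0, 0, 1, 0) + y • (0, 0, 0, 0, 0, 1, 0) + u • (0, 0, 0, 0, 0, 0, 1) := by
    have hx : x = ∑ i, x i • e i := pi_eq_sum_univ x
    have hz : z = ∑ i, z i • e i := pi_eq_sum_univ z
    ext <;> simp [Prod.fst_sum, Prod.snd_sum, e]
  rw [h]
  simp only [map_add, map_sum, map_smul, smul_eq_mul, mul_comm]

/-- An affine inequality valid on the epigraph of a definite form `q` that is homogeneous of degree
two remains valid, after homogenization by `l`, on the rotated cone over `q`. For `l > 0` this is
scaling by `l⁻¹`; for `l = 0` only the direction of `t` is left, which `hα` handles. -/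
lemma perspective_le {q : ℝ → ℝ → ℝ} (hq : ∀ r x y, q (r * x) (r * y) = r ^ 2 * q x y)
    (hq₀ : ∀ x y, q x y ≤ 0 → x = 0 ∧ y = 0) {α ξ η d C : ℝ} (hα : α ≤ 0)
    (h : ∀ t x y, q x y ≤ t → α * t + ξ * x + η * y + d ≤ C) {t l x y : ℝ}
    (hc : RotatedCone t l (q x y)) : α * t + ξ * x + η * y + d * l ≤ C * l := by
  obtain ⟨ht, hl, hc⟩ := hc
  rcases hl.eq_or_lt with rfl | hl
  · obtain ⟨rfl, rfl⟩ := hq₀ x y (by linarith)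
    nlinarith
  · have hle : q (l⁻¹ * x) (l⁻¹ * y) ≤ l⁻¹ * t := by
      rw [hq, sq, mul_assoc]
      gcongr
      rw [inv_mul_le_iff₀ hl]
      linarith
    have := mul_le_mul_of_nonneg_right (h _ _ _ hle) hl.le
    refine le_trans (le_of_eq ?_) this
    field_simp

lemma eq_zero_of_forall_mul_le {a b : ℝ} (h : ∀ r, r * a ≤ b) : a = 0 := by
  by_contra ha
  have := h ((b + 1) / a)
  rw [div_mul_cancel₀ _ ha] at this
  linarith

/-- The proof is by separation. A functional `f` with `f ≤ c` on the pieces gives, on each piece,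
an inequality in the continuous variables, where the binary variables that are free take their
best values. With `γ = max γ 0 + min γ 0` for the coefficients of the binary variables, a variable
fixed to `1` contributes `min γ 0` on top of the common constant `∑ max γ 0`. The homogenized
inequalities, weighted by the multipliers `λ`, add up to `f ≤ c` on the extended formulation. -/
lemma projection_subset_closure_convexHull_pieces {ℓ : ℕ} {Ω : ℝ} (hΩ : 0 < Ω) :
    {p | ∃ a, (p, a) ∈ extendedFormulation ℓ Ω} ⊆ closure (convexHull ℝ (pieces ℓ Ω)) := by
  rintro ⟨t, x, z, v, w, y, u⟩ ⟨a, h1, h2, h3, h4, h5, h6, h7, h8, h9, h10, h11, h12, h13, h14,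
    h15, h16, h17⟩
  by_contra hp
  obtain ⟨f, c, hf, hfp⟩ := geometric_hahn_banach_closed_point
    (convex_convexHull ℝ (pieces ℓ Ω)).closure isClosed_closure hp
  obtain ⟨α, ξ, γ, β, ω, η, μ, hrep⟩ := exists_coefficients f
  replace hf : ∀ t x z v w y u, (t, x, z, v, w, y, u) ∈ pieces ℓ Ω →
      α * t + ∑ i, ξ i * x i + ∑ i, γ i * z i + β * v + ω * w + η * y + μ * u ≤ c :=
    fun t x z v w y u h ↦ hrep t x z v w y u ▸ (hf _ (subset_closure (subset_convexHull ℝ _ h))).le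
  rw [hrep] at hfp
  refine hfp.not_ge ?_
  clear hfp hp hrep f
  have best : ∀ g : ℝ, ∃ b, Binary b ∧ g * b = max g 0 := fun g ↦ by
    rcases le_total 0 g with hg | hg
    · exact ⟨1, Or.inr rfl, by simp [hg]⟩
    · exact ⟨0, Or.inl rfl, by simp [hg]⟩
  have split : ∀ g : ℝ, g = max g 0 + min g 0 := fun g ↦ by simp [max_add_min]
  have le_split : ∀ {g l r : ℝ}, l ≤ r → r ≤ 1 → g * r ≤ max g 0 + min g 0 * l :=
    fun {g l r} hl hr ↦ by
      have e₁ := mul_le_mul_of_nonneg_left hr (le_max_right g 0)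
      have e₂ := mul_le_mul_of_nonpos_left hl (min_le_right g 0)
      calc g * r = max g 0 * r + min g 0 * r := by rw [← add_mul, ← split]
        _ ≤ _ := by linarith
  choose Z hZ hγZ using fun i ↦ best (γ i)
  obtain ⟨W, hW, hωW⟩ := best ω
  obtain ⟨U, hU, hμU⟩ := best μ
  -- The bound that is left for the continuous variables when all the binary variables take
  -- their best values.
  set C := c - ∑ i, max (γ i) 0 - max ω 0 - max μ 0 with hC
  have sum_Z : ∑ i, γ i * Z i = ∑ i, max (γ i) 0 := Finset.sum_congr rfl fun i _ ↦ hγZ i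
  have sum_Zi : ∀ i, ∑ j, γ j * (if j = i then 1 else Z j) = ∑ j, max (γ j) 0 + min (γ i) 0 :=
    fun i ↦ by
      have : ∀ j, γ j * (if j = i then 1 else Z j) =
          max (γ j) 0 + if j = i then min (γ j) 0 else 0 := fun j ↦ by
        by_cases hj : j = i
        · simp [hj, max_add_min]
        · simp [hj, hγZ]
      simp [this, Finset.sum_add_distrib]
  have sum_single : ∀ i s, ∑ j, ξ j * (Pi.single i s : Fin ℓ → ℝ) j = ξ i * s := fun i s ↦ by
    simp [Pi.single_apply]
  have Zi_binary : ∀ i j, j ≠ i → Binary (if j = i then 1 else Z j) := fun i j hj ↦ by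
    simpa [hj] using hZ j
  have bound_zero : ∀ t, 0 ≤ t → α * t ≤ C := fun t ht ↦ by
    have := hf t 0 Z 0 W 0 U (by
      simp only [pieces, Set.mem_union]
      exact .inl <| .inl <| .inl <| .inl <| .inl <| .inl <| .inl
        ⟨ht, by simp, rfl, rfl, hZ, hW, hU⟩)
    simp only [Pi.zero_apply, mul_zero, Finset.sum_const_zero] at this
    linarith
  have hC0 : 0 ≤ C := by simpa using bound_zero 0 le_rfl
  have hα : α ≤ 0 := by
    by_contra! hα
    have := bound_zero ((C + 1) / α) (by positivity)
    rw [mul_div_cancel₀ _ hα.ne'] at this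
    linarith
  -- The quadratic form of a piece with one free continuous variable is padded with the square of
  -- a second variable, later set to `0`, so that `perspective_le` applies to all the pieces.
  have bound_i : ∀ i t x y, Ω * x ^ 2 + y ^ 2 ≤ t → α * t + ξ i * x + 0 * y + min (γ i) 0 ≤ C := by
    intro i t x y ht
    have := hf t (Pi.single i x) (fun j ↦ if j = i then 1 else Z j) 0 W 0 U (by
      simp only [pieces, Set.mem_union, Set.mem_iUnion]
      exact .inl <| .inl <| .inl <| .inl <| .inl <| .inl <| .inr
        ⟨i, by simp; nlinarith, by simp +contextual, rfl, rfl, by simp, Zi_binary i, hW, hU⟩)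
    rw [sum_Zi, sum_single] at this
    linarith
  have bound_y : ∀ t x y, (1 + Ω) * y ^ 2 + x ^ 2 ≤ t → α * t + 0 * x + η * y + min μ 0 ≤ C := by
    intro t x y ht
    have := hf t 0 Z 0 W y 1 (by
      simp only [pieces, Set.mem_union, Set.mem_iUnion]
      exact .inl <| .inl <| .inl <| .inl <| .inl <| .inr
        ⟨by nlinarith, by simp, rfl, rfl, hZ, hW⟩)
    simp only [Pi.zero_apply, mul_zero, Finset.sum_const_zero] at this
    linarith [split μ]
  have bound_v : ∀ t x v, v ^ 2 + x ^ 2 ≤ t → α * t + 0 * x + β * v + min ω 0 ≤ C := by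
    intro t x v ht
    have := hf t 0 Z v 1 0 U (by
      simp only [pieces, Set.mem_union, Set.mem_iUnion]
      exact .inl <| .inl <| .inl <| .inl <| .inr
        ⟨by nlinarith, by simp, rfl, rfl, hZ, hU⟩)
    simp only [Pi.zero_apply, mul_zero, Finset.sum_const_zero] at this
    linarith [split ω]
  have bound_yv : ∀ t y v, (y - v) ^ 2 + Ω * y ^ 2 ≤ t →
      α * t + η * y + β * v + (min ω 0 + min μ 0) ≤ C := by
    intro t y v ht
    have := hf t 0 Z v 1 y 1 (by
      simp only [pieces, Set.mem_union, Set.mem_iUnion]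
      exact .inl <| .inl <| .inl <| .inr ⟨ht, by simp, rfl, rfl, hZ⟩)
    simp only [Pi.zero_apply, mul_zero, Finset.sum_const_zero] at this
    linarith [split ω, split μ]
  have bound_iy : ∀ i t x y, y ^ 2 + Ω * (y - x) ^ 2 ≤ t →
      α * t + ξ i * x + η * y + (min (γ i) 0 + min μ 0) ≤ C := by
    intro i t x y ht
    have := hf t (Pi.single i x) (fun j ↦ if j = i then 1 else Z j) 0 W y 1 (by
      simp only [pieces, Set.mem_union, Set.mem_iUnion]
      exact .inl <| .inl <| .inr
        ⟨i, by simpa using ht, by simp +contextual, rfl, by simp, rfl, Zi_binary i, hW⟩)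
    rw [sum_Zi, sum_single] at this
    linarith [split μ]
  have bound_iv : ∀ i t x v, v ^ 2 + Ω * x ^ 2 ≤ t →
      α * t + ξ i * x + β * v + (min (γ i) 0 + min ω 0) ≤ C := by
    intro i t x v ht
    have := hf t (Pi.single i x) (fun j ↦ if j = i then 1 else Z j) v 1 0 U (by
      simp only [pieces, Set.mem_union, Set.mem_iUnion]
      exact .inl <| .inr
        ⟨i, by simpa using ht, by simp +contextual, rfl, by simp, rfl, Zi_binary i, hU⟩)
    rw [sum_Zi, sum_single] at this
    linarith [split ω]
  have bound_R : ∀ x : Fin ℓ → ℝ, ∑ i, ξ i * x i + (β + η) * ∑ i, x i +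
      (∑ i, min (γ i) 0 + min ω 0 + min μ 0) ≤ C := by
    intro x
    have := hf 0 x (fun _ ↦ 1) (∑ i, x i) 1 (∑ i, x i) 1 (by
      simp only [pieces, Set.mem_union, Set.mem_iUnion]
      exact .inr ⟨le_rfl, by simp, rfl, by simp, rfl, rfl⟩)
    have hsum : ∑ i, γ i * 1 = ∑ i, max (γ i) 0 + ∑ i, min (γ i) 0 := by
      rw [← Finset.sum_add_distrib]
      exact Finset.sum_congr rfl fun i _ ↦ by rw [mul_one, ← split]
    linarith [split ω, split μ]
  -- `R` contains a line in each of its directions, so `f` vanishes on them.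
  have dirR : ∑ i, ξ i * a (.x_R i) + (β + η) * ∑ i, a (.x_R i) = 0 := by
    refine eq_zero_of_forall_mul_le
      (b := C - (∑ i, min (γ i) 0 + min ω 0 + min μ 0)) fun r ↦ ?_
    have := bound_R fun i ↦ r * a (.x_R i)
    simp only [mul_left_comm _ r, ← Finset.mul_sum] at this
    linarith
  have pR : (∑ i, min (γ i) 0 + min ω 0 + min μ 0) * a .lam_R ≤ C * a .lam_R :=
    mul_le_mul_of_nonneg_right (by simpa using bound_R 0) h11
  have sq0 : ∀ {s : ℝ}, s ^ 2 ≤ 0 → s = 0 := fun h ↦ pow_eq_zero_iff two_ne_zero |>.1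
    (le_antisymm h (sq_nonneg _))
  have pos : ∀ s : ℝ, 0 ≤ Ω * s ^ 2 := fun s ↦ by positivity
  have sqΩ : ∀ {s : ℝ}, Ω * s ^ 2 ≤ 0 → s = 0 := fun {s} h ↦ sq0 (by nlinarith [sq_nonneg s])
  have pi := fun i ↦ perspective_le (q := fun x y ↦ Ω * x ^ 2 + y ^ 2) (by intros; ring)
    (fun x y h ↦ ⟨sqΩ (by linarith [sq_nonneg y]), sq0 (by linarith [pos x])⟩)
    hα (bound_i i) (y := 0) (by simpa using h12 i)
  have py := perspective_le (q := fun x y ↦ (1 + Ω) * y ^ 2 + x ^ 2) (by intros; ring)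
    (fun x y h ↦ ⟨sq0 (by linarith [sq_nonneg y, pos y]), sq0 (by linarith [sq_nonneg x, pos y])⟩)
    hα bound_y (x := 0) (by simpa using h13)
  have pv := perspective_le (q := fun x v ↦ v ^ 2 + x ^ 2) (by intros; ring)
    (fun x y h ↦ ⟨sq0 (by linarith [sq_nonneg y]), sq0 (by linarith [sq_nonneg x])⟩)
    hα bound_v (x := 0) (by simpa using h14)
  have pyv := perspective_le (q := fun y v ↦ (y - v) ^ 2 + Ω * y ^ 2) (by intros; ring)
    (fun y v h ↦ by
      obtain rfl : y = 0 := sqΩ (by linarith [sq_nonneg (y - v)])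
      exact ⟨rfl, sq0 (by linarith)⟩) hα bound_yv h17
  have piy := fun i ↦ perspective_le (q := fun x y ↦ y ^ 2 + Ω * (y - x) ^ 2) (by intros; ring)
    (fun x y h ↦ by
      obtain rfl : y = 0 := sq0 (by linarith [pos (y - x)])
      exact ⟨sqΩ (by linarith), rfl⟩) hα (bound_iy i) (h15 i)
  have piv := fun i ↦ perspective_le (q := fun x v ↦ v ^ 2 + Ω * x ^ 2) (by intros; ring)
    (fun x v h ↦ ⟨sqΩ (by linarith [sq_nonneg v]), sq0 (by linarith [pos x])⟩) hα (bound_iv i) (h16 i)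
  have spi := Finset.sum_le_sum fun i (_ : i ∈ Finset.univ) ↦ pi i
  have spiy := Finset.sum_le_sum fun i (_ : i ∈ Finset.univ) ↦ piy i
  have spiv := Finset.sum_le_sum fun i (_ : i ∈ Finset.univ) ↦ piv i
  -- The lower bounds `∑ λ ≤ z` matter only for negative coefficients, the bounds `z ≤ 1` only for
  -- positive ones.
  have qz := Finset.sum_le_sum fun i (_ : i ∈ Finset.univ) ↦
    le_split (g := γ i) (h7 i).1 (h7 i).2
  have qu := le_split (g := μ) h8.1 h8.2
  have qw := le_split (g := ω) h9.1 h9.2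
  have qt := mul_le_mul_of_nonpos_left h1 hα
  have ql := mul_le_mul_of_nonneg_left h10 hC0
  have hξ : ∑ i, ξ i * x i = ∑ i, ξ i * a (.x_i i) + ∑ i, ξ i * a (.x_iy i) +
      ∑ i, ξ i * a (.x_iv i) + ∑ i, ξ i * a (.x_R i) := by
    simp only [h2, mul_add, Finset.sum_add_distrib]
  rw [hξ, h3, h4]
  simp only [mul_add, add_mul, zero_mul, mul_zero, Finset.sum_add_distrib, ← Finset.mul_sum,
    Finset.sum_const_zero, ← Finset.sum_mul] at *
  rw [h5, h6]
  linarith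

end SignalDenoising

theorem proposition6 (ℓ : ℕ) (Ω : ℝ) (hΩ : 0 < Ω) :
    closure (convexHull ℝ (SignalDenoising.Q₂ ℓ Ω)) =
      {p | ∃ a : SignalDenoising.AuxVar ℓ → ℝ,
        (p, a) ∈ SignalDenoising.extendedFormulation ℓ Ω} ∧
    Nat.card (SignalDenoising.AuxVar ℓ) = 12 * ℓ + 13 ∧
    closure (convexHull ℝ (SignalDenoising.Q₂ ℓ Ω)) =
      closure (convexHull ℝ
        (SignalDenoising.V₀ ℓ ∪ (⋃ i, SignalDenoising.Vᵢ ℓ Ω i) ∪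
          SignalDenoising.Vy ℓ Ω ∪ SignalDenoising.Vv ℓ ∪ SignalDenoising.Vyv ℓ Ω ∪
          (⋃ i, SignalDenoising.Vᵢy ℓ Ω i) ∪ (⋃ i, SignalDenoising.Vᵢv ℓ Ω i) ∪
          SignalDenoising.R ℓ)) := by
  open SignalDenoising in
  change _ ∧ _ ∧ _ = closure (convexHull ℝ (pieces ℓ Ω))
  have hQE : closure (convexHull ℝ (Q₂ ℓ Ω)) ⊆
      {p | ∃ a : AuxVar ℓ → ℝ, (p, a) ∈ extendedFormulation ℓ Ω} :=
    closure_minimal (convexHull_min (Q₂_subset_projection hΩ) (convex_projection hΩ))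
      (isClosed_projection hΩ)
  have hEP := projection_subset_closure_convexHull_pieces (ℓ := ℓ) hΩ
  have hPQ := closure_mono (convexHull_mono (𝕜 := ℝ) (pieces_subset_Q₂ ℓ Ω))
  exact ⟨hQE.antisymm (hEP.trans hPQ), card_auxVar ℓ, (hQE.trans hEP).antisymm hPQ⟩
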